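/- Posets are non-empty and given by their strict orders. Let $\mathcal P$ be the countable set of isomorphism classes of finite posets. For $Q,P\in\mathcal P$ let $t(Q,P)$ be the proportion of all maps $Q\to P$ that are poset homomorphisms (that is, $x<_Q y$ implies $\varphi(x)<_P\varphi(y)$). Identify $\mathcal P$ with its image under the injective map $P\mapsto\bigl((t(Q,P))_{Q\in\mathcal P},\,1/|P|\bigr)\in[0,1]^{\mathcal P}\times[0,1]$, let $\overline{\mathcal P}$ be its closure, and let $\mathcal P_\infty=\overline{\mathcal P}\setminus\mathcal P$ be the space of proper poset limits, with the subspace topology; $t(Q,\cdot)$ is extended by continuity to $\overline{\mathcal P}$. For a finite poset $Q$ let $n(Q)$ be the number of elements of $Q$ that are comparable to some other element of $Q$. **Theorem.** The space $\mathcal P_\infty$ is contractible, and in particular connected and simply connected. More precisely, there are a point $\Pi_E\in\mathcal P_\infty$, with $t(Q,\Pi_E)=1$ if no two elements of $Q$ are comparable and $t(Q,\Pi_E)=0$ otherwise, and a continuous map $\Psi:\mathcal P_\infty\times[0,1]\to\mathcal P_\infty$ with $\Psi(\Pi,0)=\Pi$ and $\Psi(\Pi,1)=\Pi_E$ for all $\Pi$,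 such that $\Pi_{(p)}:=\Psi(\Pi,1-p)$ is the following thinning of $\Pi$, for every $\Pi\in\mathcal P_\infty$ and $p\in[0,1]$. 1. $t(Q,\Pi_{(p)})=p^{\,n(Q)}\,t(Q,\Pi)$ for every finite poset $Q$ (with $0^0=1$). 2. Say that a random poset $R$ on $\mathbb N$ is a version of $P(\infty,\Pi)$ if $\mathbb P(Q\subset R)=t(Q,\Pi)$ for every finite poset $Q$ with ground set an initial segment of $\mathbb N$; this determines the distribution of $R$. Such an $R$ exists for every $\Pi$. If $R$ is a version of $P(\infty,\Pi)$ and each $i\in\mathbb N$ is, with probability $1-p$, independently of the other points and of $R$, made incomparable to everything, then the resulting random poset is a version of $P(\infty,\Pi_{(p)})$. 3. Let $(S,\mu)$ be a probability space with a partial order $\prec$ such that $\{(x,y):x\prec y\}$ is measurable in $S\times S$, and let $W:S\times S\to[0,1]$ be a measurable function such that $W(x,y)>0$ implies $x\prec y$, and $W(x,y)>0$, $W(y,z)>0$ imply $W(x,z)=1$. Suppose that $W$ represents $\Pi$, that is, $t(Q,\Pi)=\int_{S^{|Q|}}\prod_{i<_Qj}W(x_i,x_j)\,d\mu(x_1)\cdots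 d\mu(x_{|Q|})$ for every finite poset $Q$. Add to $S$ a new point $*$ of mass $1-p$, incomparable to everything, replace $\mu$ by $p\mu$ on $S$, and extend $W$ by $W(*,x)=W(x,*)=W(*,*)=0$. Then the extended kernel represents $\Pi_{(p)}$. -/

import Mathlib

open MeasureTheory ProbabilityTheory unitInterval

/-- A finite non-empty labelled poset with ground set `Fin n` (`n ≥ 1`), given by its strict
order relation. -/
structure FinPoset where
  /-- the number of elements -/
  n : ℕ
  pos : 0 < n
  /-- the strict order `<` -/
  lt : Fin n → Fin n → Prop
  irrefl : ∀ x, ¬ lt x x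
  trans : ∀ x y z, lt x y → lt y z → lt x z

/-- Isomorphism of finite posets. -/
instance FinPoset.isoSetoid : Setoid FinPoset where
  r P Q := Nonempty (P.lt ≃r Q.lt)
  iseqv :=
    { refl := fun P => ⟨RelIso.refl P.lt⟩
      symm := fun ⟨e⟩ => ⟨e.symm⟩
      trans := fun ⟨e⟩ ⟨f⟩ => ⟨e.trans f⟩ }

/-- The set of unlabelled finite posets, i.e. isomorphism classes of finite posets. -/
def UPoset : Type := Quotient FinPoset.isoSetoid

/-- The unlabelled poset underlying a labelled one. -/
def FinPoset.unlabel (P : FinPoset) : UPoset := Quotient.mk FinPoset.isoSetoid P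

theorem FinPoset.card_eq_of_equiv {P Q : FinPoset} (h : P ≈ Q) : P.n = Q.n := by
  obtain ⟨e⟩ := h
  simpa using Fintype.card_congr e.toEquiv

/-- The number of elements of an unlabelled finite poset. -/
def UPoset.size (P : UPoset) : ℕ :=
  Quotient.lift FinPoset.n (fun _ _ h => FinPoset.card_eq_of_equiv h) P

/-- `t(Q, P)` for labelled posets: the proportion of all maps `Q → P` which are poset
homomorphisms. -/
noncomputable def FinPoset.homDensity (Q P : FinPoset) : ℝ :=
  (Nat.card (Q.lt →r P.lt) : ℝ) / (Nat.card (Fin Q.n → Fin P.n) : ℝ)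

theorem FinPoset.homDensity_mem (Q P : FinPoset) : Q.homDensity P ∈ Set.Icc (0 : ℝ) 1 := by
  refine ⟨by unfold FinPoset.homDensity; positivity, ?_⟩
  refine div_le_one_of_le₀ ?_ (by positivity)
  exact_mod_cast Nat.card_le_card_of_injective (fun f : Q.lt →r P.lt => (f : Fin Q.n → Fin P.n))
    DFunLike.coe_injective

theorem FinPoset.homDensity_congr {Q P Q' P' : FinPoset} (hQ : Q ≈ Q') (hP : P ≈ P') :
    Q.homDensity P = Q'.homDensity P' := by
  have h1 := FinPoset.card_eq_of_equiv hQ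
  have h2 := FinPoset.card_eq_of_equiv hP
  obtain ⟨e⟩ := hQ
  obtain ⟨f⟩ := hP
  have h3 : Nat.card (Q.lt →r P.lt) = Nat.card (Q'.lt →r P'.lt) := by
    refine Nat.card_congr
      { toFun := fun g => (f.toRelEmbedding.toRelHom.comp g).comp e.symm.toRelEmbedding.toRelHom
        invFun := fun g => (f.symm.toRelEmbedding.toRelHom.comp g).comp e.toRelEmbedding.toRelHom
        left_inv := fun g => by ext x; simp
        right_inv := fun g => by ext x; simp }
  unfold FinPoset.homDensity
  rw [h3]
  simp only [Nat.card_eq_fintype_card, Fintype.card_pi_const, Fintype.card_fin, h1, h2]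

/-- `t(Q, P) ∈ [0,1]` for unlabelled finite posets. -/
noncomputable def UPoset.homDensity (Q P : UPoset) : I :=
  Quotient.lift₂ (fun Q P : FinPoset => (⟨Q.homDensity P, Q.homDensity_mem P⟩ : I))
    (fun _ _ _ _ hQ hP => Subtype.ext (FinPoset.homDensity_congr hQ hP)) Q P

/-- The embedding `P ↦ ((t(Q, P))_Q, 1/|P|)` of the set of unlabelled finite posets into the
compact metrizable space `[0,1]^𝒫 × [0,1]`. -/
noncomputable def UPoset.embed (P : UPoset) : (UPoset → I) × I :=
  (fun Q => Q.homDensity P,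
    ⟨(P.size : ℝ)⁻¹, by positivity, Nat.cast_inv_le_one P.size⟩)

/-- The set of poset limits: the closure of the set of finite posets. -/
noncomputable def posetLimits : Set ((UPoset → I) × I) := closure (Set.range UPoset.embed)

/-- The set of proper poset limits: the poset limits which are not finite posets. -/
noncomputable def properPosetLimits : Set ((UPoset → I) × I) :=
  posetLimits \ Set.range UPoset.embed

/-- The space of proper poset limits, with the subspace topology of `[0,1]^𝒫 × [0,1]`. -/
abbrev ProperPosetLimit : Type := properPosetLimits

/-- The functional `t(Q, ·)` extended by continuity to (proper) poset limits, i.e. the coordinate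
with index `Q`. -/
noncomputable def ProperPosetLimit.t (Q : FinPoset) (Γ : ProperPosetLimit) : ℝ :=
  ((Γ : (UPoset → I) × I).1 Q.unlabel : ℝ)

/-- The number of elements of `Q` that are comparable to at least one other element. -/
noncomputable def FinPoset.numComparable (Q : FinPoset) : ℕ :=
  Nat.card {x : Fin Q.n // ∃ y, Q.lt x y ∨ Q.lt y x}

/-- A kernel on an ordered probability space; the order `prec` on `S` is part of the data, and the
probability measure is a separate argument below. -/
structure PosetKernel (S : Type*) [MeasurableSpace S] where
  /-- the partial order on `S`, as a strict order -/
  prec : S → S → Prop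
  prec_irrefl : ∀ x, ¬ prec x x
  prec_trans : ∀ x y z, prec x y → prec y z → prec x z
  measurableSet_prec : MeasurableSet {z : S × S | prec z.1 z.2}
  /-- the kernel -/
  W : S → S → ℝ
  measurable_W : Measurable (fun z : S × S => W z.1 z.2)
  W_mem : ∀ x y, W x y ∈ Set.Icc (0 : ℝ) 1
  prec_of_pos : ∀ x y, 0 < W x y → prec x y
  eq_one_of_pos : ∀ x y z, 0 < W x y → 0 < W y z → W x z = 1

open Classical in
/-- The kernel `K` on `(S, μ)` represents the proper poset limit `Γ`:
`t(Q, Γ) = ∫ ∏_{i <_Q j} W(x_i, x_j) dμ(x_1) ⋯ dμ(x_|Q|)` for every finite poset `Q`. -/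
def PosetKernel.Represents {S : Type*} [MeasurableSpace S] (K : PosetKernel S) (μ : Measure S)
    (Γ : ProperPosetLimit) : Prop :=
  ∀ Q : FinPoset, Γ.t Q =
    ∫ x : Fin Q.n → S, (∏ i, ∏ j, if Q.lt i j then K.W (x i) (x j) else 1)
      ∂(Measure.pi fun _ => μ)

theorem measurableEmbedding_map_inl_inl (S : Type*) [MeasurableSpace S] :
    MeasurableEmbedding
      (Prod.map (Sum.inl : S → S ⊕ Unit) (Sum.inl : S → S ⊕ Unit)) := by
  have h : MeasurableEmbedding (Sum.inl : S → S ⊕ Unit) :=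
    ⟨Sum.inl_injective, measurable_inl, fun _ hs => measurableSet_inl_image.mpr hs⟩
  exact h.prodMap h

/-- The extension of a kernel on `S` to `S ∪ {*}`, with `*` incomparable to everything and the
kernel vanishing when one of its arguments is `*`. -/
def PosetKernel.addPoint {S : Type*} [MeasurableSpace S] (K : PosetKernel S) :
    PosetKernel (S ⊕ Unit) where
  prec
    | Sum.inl x, Sum.inl y => K.prec x y
    | _, _ => False
  prec_irrefl := by
    rintro (x | x)
    · exact K.prec_irrefl x
    · exact id
  prec_trans := by
    rintro (x | x) (y | y) (z | z) h1 h2 <;> first | exact h1.elim | exact h2.elim | skip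
    exact K.prec_trans x y z h1 h2
  measurableSet_prec := by
    have he := measurableEmbedding_map_inl_inl S
    convert he.measurableSet_image.mpr K.measurableSet_prec using 1
    ext ⟨x | x, y | y⟩ <;> simp
  W
    | Sum.inl x, Sum.inl y => K.W x y
    | _, _ => 0
  measurable_W := by
    have he := measurableEmbedding_map_inl_inl S
    convert he.measurable_extend K.measurable_W (measurable_const (a := (0 : ℝ))) using 1
    ext ⟨x | x, y | y⟩
    · exact (he.injective.extend_apply (fun z : S × S => K.W z.1 z.2) (fun _ => (0 : ℝ)) (x, y)).symm
    all_goals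
      rw [Function.extend_apply']
      rintro ⟨⟨a, b⟩, h⟩
      simp at h
  W_mem := by
    rintro (x | x) (y | y)
    · exact K.W_mem x y
    all_goals simp
  prec_of_pos := by
    rintro (x | x) (y | y) h
    · exact K.prec_of_pos x y h
    all_goals exact (lt_irrefl _ h).elim
  eq_one_of_pos := by
    rintro (x | x) (y | y) (z | z) h1 h2 <;>
      first | exact (lt_irrefl _ h1).elim | exact (lt_irrefl _ h2).elim | skip
    exact K.eq_one_of_pos x y z h1 h2

/-- The measure on `S ∪ {*}` with mass `1 - p` at `*` and equal to `p μ` on `S`. -/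
noncomputable def addPointMeasure {S : Type*} [MeasurableSpace S] (μ : Measure S) (p : I) :
    Measure (S ⊕ Unit) :=
  ENNReal.ofReal p • μ.map Sum.inl + ENNReal.ofReal (1 - p) • Measure.dirac (Sum.inr ())

/-- `R` is (a version of) the exchangeable random infinite poset `P(∞, Γ)` of the proper poset
limit `Γ`: a random poset on `ℕ` which contains every finite labelled poset `Q` with probability
`t(Q, Γ)`. This determines the distribution of `R`. -/
def IsInfinitePosetOf {Ω : Type*} [MeasurableSpace Ω] (P : Measure Ω) (R : Ω → ℕ → ℕ → Prop)
    (Γ : ProperPosetLimit) : Prop :=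
  Measurable R ∧ (∀ ω, IsStrictOrder ℕ (R ω)) ∧
    ∀ Q : FinPoset, P.real {ω | ∀ i j : Fin Q.n, Q.lt i j → R ω i j} = Γ.t Q

/-- `keep` is a family of independent events `keep i` of probability `p` each, jointly independent
of the random relation `R`. -/
def IsThinningOf {Ω : Type*} [MeasurableSpace Ω] (P : Measure Ω) (R : Ω → ℕ → ℕ → Prop)
    (keep : ℕ → Ω → Prop) (p : I) : Prop :=
  (∀ i, Measurable (keep i)) ∧ (∀ i, P.real {ω | keep i ω} = p) ∧ iIndepFun keep P ∧
    IndepFun (fun ω i => keep i ω) R P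

/-- The random relation obtained from `R` by making every `i` which is not kept incomparable to
everything. -/
def thinRel {Ω : Type*} (R : Ω → ℕ → ℕ → Prop) (keep : ℕ → Ω → Prop) : Ω → ℕ → ℕ → Prop :=
  fun ω i j => keep i ω ∧ keep j ω ∧ R ω i j

/-! If each point of a sampled poset is kept with probability p and otherwise made incomparable to
everything, then a copy of Q survives exactly when all its comparable elements are kept. So thinning
multiplies t(Q, ·) by p ^ n(Q), and every assertion reduces to this formula. On coordinate vectors
it is the jointly continuous map `thinVector`.

The point to prove is that thinning preserves the proper limits. For a finite P, replace each
element by b copies and keep only a of them comparable: the densities are multiplied by exactly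
(a/b) ^ n(Q) (`homDensity_thinnedBlowUp`). With a/b → p and b → ∞ the thinned vector of P is a limit
of finite posets, and continuity extends this to the whole closure. The result is proper, since its
last coordinate is 0 and no finite poset has 1/|P| = 0. Conversely every proper limit has last
coordinate 0 (`snd_eq_zero`), so p = 1 gives the identity, while p = 0 leaves one common limit
without comparabilities. This is the contraction.

Versions of P(∞, Π) exist by compactness of the space of laws of orders on ℕ. Both thinning
statements then follow by independence; for kernels, the enlarged probability space is realised as a
pushforward of S times a coin. -/

/-! ### Thinned blow-ups of finite posets -/

namespace FinPoset

/-- `x` is comparable to some other element of `Q`. -/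
def IsComparable (Q : FinPoset) (x : Fin Q.n) : Prop := ∃ y, Q.lt x y ∨ Q.lt y x

open Classical in
theorem prod_ite_isComparable {M : Type*} [CommMonoid M] (Q : FinPoset) (c : M) :
    ∏ x, (if Q.IsComparable x then c else 1) = c ^ Q.numComparable := by
  rw [Finset.prod_ite, Finset.prod_const, Finset.prod_const_one, mul_one, numComparable,
    Nat.card_eq_fintype_card, Fintype.card_subtype]
  congr!

theorem numComparable_congr {P Q : FinPoset} (h : P ≈ Q) :
    P.numComparable = Q.numComparable := by
  obtain ⟨e⟩ := h
  refine Nat.card_congr (e.toEquiv.subtypeEquiv fun x => ?_)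
  constructor
  · rintro ⟨y, hy⟩
    exact ⟨e y, hy.imp e.map_rel_iff.2 e.map_rel_iff.2⟩
  · rintro ⟨y, hy⟩
    obtain ⟨z, rfl⟩ := e.surjective y
    exact ⟨z, hy.imp e.map_rel_iff.1 e.map_rel_iff.1⟩

theorem numComparable_eq_zero {Q : FinPoset} (h : ¬ ∃ x y, Q.lt x y) : Q.numComparable = 0 := by
  have : IsEmpty {x : Fin Q.n // ∃ y, Q.lt x y ∨ Q.lt y x} :=
    ⟨fun ⟨x, y, hxy⟩ => h (hxy.elim (fun h => ⟨x, y, h⟩) fun h => ⟨y, x, h⟩)⟩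
  exact Nat.card_of_isEmpty

theorem numComparable_ne_zero {Q : FinPoset} (h : ∃ x y, Q.lt x y) : Q.numComparable ≠ 0 := by
  obtain ⟨x, y, hxy⟩ := h
  have : Nonempty {x : Fin Q.n // ∃ y, Q.lt x y ∨ Q.lt y x} := ⟨⟨x, y, Or.inl hxy⟩⟩
  exact Nat.card_pos.ne'

theorem homDensity_eq_one {Q : FinPoset} (h : ¬ ∃ x y, Q.lt x y) (P : FinPoset) :
    Q.homDensity P = 1 := by
  have hcard : Nat.card (Q.lt →r P.lt) = Nat.card (Fin Q.n → Fin P.n) :=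
    Nat.card_congr ⟨fun f => f, fun f => ⟨f, fun {a b} hab => (h ⟨a, b, hab⟩).elim⟩,
      fun _ => rfl, fun _ => rfl⟩
  have : Nonempty (Fin P.n) := ⟨⟨0, P.pos⟩⟩
  rw [homDensity, hcard, div_self]
  exact_mod_cast Nat.card_pos.ne'

/-- The poset obtained from `P` by replacing every element by `b` pairwise incomparable copies
and making all but the first `a` copies of each element incomparable to everything. -/
def thinnedBlowUp (P : FinPoset) (a b : ℕ) (hb : 0 < b) : FinPoset where
  n := P.n * b
  pos := Nat.mul_pos P.pos hb
  lt x y := (finProdFinEquiv.symm x).2.1 < a ∧ (finProdFinEquiv.symm y).2.1 < a ∧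
    P.lt (finProdFinEquiv.symm x).1 (finProdFinEquiv.symm y).1
  irrefl _ h := P.irrefl _ h.2.2
  trans _ _ _ h h' := ⟨h.1, h'.2.1, P.trans _ _ _ h.2.2 h'.2.2⟩

/-- A homomorphism into a thinned blow-up is a homomorphism into the original poset together with
a choice of copies which takes comparable elements to copies that were kept. -/
def homThinnedBlowUpEquiv (Q P : FinPoset) (a b : ℕ) (hb : 0 < b) :
    (Q.lt →r (P.thinnedBlowUp a b hb).lt) ≃
      (Q.lt →r P.lt) × {g : Fin Q.n → Fin b // ∀ x, Q.IsComparable x → (g x).1 < a} where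
  toFun f :=
    (⟨fun x => (finProdFinEquiv.symm (f x)).1, fun h => (f.map_rel h).2.2⟩,
      ⟨fun x => (finProdFinEquiv.symm (f x)).2, by
        rintro x ⟨y, h | h⟩
        · exact (f.map_rel h).1
        · exact (f.map_rel h).2.1⟩)
  invFun f := ⟨fun x => finProdFinEquiv (f.1 x, f.2.1 x), fun {x y} h => by
    simp only [thinnedBlowUp, Equiv.symm_apply_apply]
    exact ⟨f.2.2 x ⟨y, Or.inl h⟩, f.2.2 y ⟨x, Or.inr h⟩, f.1.map_rel h⟩⟩
  left_inv f := by
    ext x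
    exact congrArg Fin.val (finProdFinEquiv.apply_symm_apply (f x))
  right_inv f := by
    refine Prod.ext (RelHom.ext fun x => ?_) (Subtype.ext (funext fun x => ?_))
    · exact congrArg Prod.fst (finProdFinEquiv.symm_apply_apply (f.1 x, f.2.1 x))
    · exact congrArg Prod.snd (finProdFinEquiv.symm_apply_apply (f.1 x, f.2.1 x))

-- The condition is imposed on each element separately, so the choices form a product of finite
-- sets.
open Classical in
theorem card_copyChoices (Q : FinPoset) {a b : ℕ} (hab : a ≤ b) :
    Nat.card {g : Fin Q.n → Fin b // ∀ x, Q.IsComparable x → (g x).1 < a} =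
      ∏ x, if Q.IsComparable x then a else b := by
  have h : ∀ x, (if Q.IsComparable x then a else b) =
      ({k | Q.IsComparable x → k.1 < a} : Finset (Fin b)).card := by
    intro x
    split_ifs with hx
    · simp [hx, Fin.card_filter_val_lt, hab]
    · simp [hx]
  simp_rw [h]
  rw [← Fintype.card_piFinset, Nat.card_eq_fintype_card, Fintype.card_subtype]
  congr 1
  ext g
  simp [Fintype.mem_piFinset]

theorem homDensity_thinnedBlowUp (Q P : FinPoset) {a b : ℕ} (hb : 0 < b) (hab : a ≤ b) :
    Q.homDensity (P.thinnedBlowUp a b hb) =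
      ((a : ℝ) / b) ^ Q.numComparable * Q.homDensity P := by
  classical
  have hb' : (b : ℝ) ≠ 0 := by exact_mod_cast hb.ne'
  have key : ((∏ x, if Q.IsComparable x then a else b : ℕ) : ℝ) / (b : ℝ) ^ Q.n =
      ((a : ℝ) / b) ^ Q.numComparable := by
    rw [← prod_ite_isComparable]
    have : (b : ℝ) ^ Q.n = ∏ _x : Fin Q.n, (b : ℝ) := by simp
    rw [this, Nat.cast_prod, ← Finset.prod_div_distrib]
    refine Finset.prod_congr rfl fun x _ => ?_
    split_ifs <;> simp [hb']
  rw [← key, homDensity, homDensity, Nat.card_congr (homThinnedBlowUpEquiv Q P a b hb),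
    Nat.card_prod, card_copyChoices Q hab]
  simp only [Nat.card_eq_fintype_card, Fintype.card_pi_const, Fintype.card_fin, thinnedBlowUp,
    mul_pow, Nat.cast_mul, Nat.cast_pow]
  rw [mul_comm ((P.n : ℝ) ^ Q.n), mul_div_mul_comm, mul_comm]
  ring

end FinPoset

/-! ### Thinning of poset limits -/

namespace UPoset

/-- The number of elements of an unlabelled poset that are comparable to another element. -/
noncomputable def numComparable (Q : UPoset) : ℕ :=
  Quotient.lift FinPoset.numComparable (fun _ _ h => FinPoset.numComparable_congr h) Q

/-- A poset is determined by its size k and a relation on `Fin k`. Finiteness makes the embedded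
posets of bounded size a closed set. -/
theorem finite_size_le (N : ℕ) : {P : UPoset | P.size ≤ N}.Finite := by
  let f : (Σ k : Fin (N + 1), Fin k.1 → Fin k.1 → Prop) → Set FinPoset := fun s =>
    {P | ∃ h : P.n = s.1.1, ∀ x y, P.lt x y ↔ s.2 (Fin.cast h x) (Fin.cast h y)}
  have hf : ∀ s, (f s).Subsingleton := by
    rintro ⟨⟨k, hk⟩, r⟩ ⟨n, hn, lt, h1, h2⟩ ⟨h, hlt⟩ ⟨n', hn', lt', h1', h2'⟩ ⟨h', hlt'⟩
    obtain rfl : n = k := h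
    obtain rfl : n' = n := h'
    have : lt = lt' := by
      ext x y
      exact (hlt x y).trans (hlt' x y).symm
    subst this
    rfl
  refine ((Set.finite_iUnion fun s => (hf s).finite).image FinPoset.unlabel).subset ?_
  intro P hP
  induction P using Quotient.inductionOn with
  | h P =>
    refine ⟨P, Set.mem_iUnion.2 ⟨⟨⟨P.n, Nat.lt_succ_of_le hP⟩, P.lt⟩, rfl, fun x y => Iff.rfl⟩, rfl⟩

end UPoset

/-- The thinning of a vector of densities: `t(Q, ·)` is multiplied by `p ^ n(Q)`, and the
coordinate `1 / |P|` is replaced by `0`. -/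
noncomputable def thinVector (x : (UPoset → I) × I) (p : I) : (UPoset → I) × I :=
  (fun Q => p ^ Q.numComparable * x.1 Q, 0)

theorem continuous_thinVector :
    Continuous fun z : ((UPoset → I) × I) × I => thinVector z.1 z.2 := by
  unfold thinVector
  fun_prop

theorem thinVector_embed_mem (P : FinPoset) (p : I) :
    thinVector P.unlabel.embed p ∈ posetLimits := by
  -- The number of kept copies among b + 1 is ⌊p(b + 1)⌋: the ratio tends to p, and the shift by one
  -- keeps the blow-up non-empty.
  have hle : ∀ b : ℕ, ⌊(p : ℝ) * ((b + 1 : ℕ) : ℝ)⌋₊ ≤ b + 1 := fun b =>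
    Nat.floor_le_of_le (mul_le_of_le_one_left (by positivity) p.2.2)
  refine mem_closure_of_tendsto (b := Filter.atTop) (f := fun b : ℕ =>
    (P.thinnedBlowUp ⌊(p : ℝ) * ((b + 1 : ℕ) : ℝ)⌋₊ (b + 1) b.succ_pos).unlabel.embed) ?_
    (Filter.Eventually.of_forall fun b => Set.mem_range_self _)
  refine Filter.Tendsto.prodMk_nhds (tendsto_pi_nhds.2 fun Q => ?_) ?_
  · induction Q using Quotient.inductionOn with
    | h Q =>
      rw [tendsto_subtype_rng]
      change Filter.Tendsto (fun b : ℕ => Q.homDensity (P.thinnedBlowUp _ _ _)) _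
        (nhds (((p ^ Q.numComparable * ⟨Q.homDensity P, Q.homDensity_mem P⟩ : I)) : ℝ))
      simp_rw [FinPoset.homDensity_thinnedBlowUp Q P (Nat.succ_pos _) (hle _)]
      have h1 : Filter.Tendsto (fun b : ℕ => (⌊(p : ℝ) * ((b + 1 : ℕ) : ℝ)⌋₊ : ℝ) /
          ((b + 1 : ℕ) : ℝ)) Filter.atTop (nhds (p : ℝ)) :=
        ((tendsto_nat_floor_mul_div_atTop p.2.1).comp tendsto_natCast_atTop_atTop).comp
          (Filter.tendsto_add_atTop_nat 1)
      exact (h1.pow _).mul_const _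
  · rw [tendsto_subtype_rng]
    change Filter.Tendsto (fun b : ℕ => ((P.n * (b + 1) : ℕ) : ℝ)⁻¹) _ (nhds 0)
    refine tendsto_inv_atTop_zero.comp (tendsto_natCast_atTop_atTop.comp ?_)
    -- The size P.n * (b + 1) is at least b because P is non-empty.
    exact Filter.tendsto_atTop_mono (fun b => (Nat.le_succ b).trans
      (Nat.le_mul_of_pos_left _ P.pos)) Filter.tendsto_id

theorem thinVector_mem_posetLimits {x : (UPoset → I) × I} (hx : x ∈ posetLimits) (p : I) :
    thinVector x p ∈ posetLimits := by
  refine closure_minimal (s := Set.range UPoset.embed)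
    (t := (fun x => thinVector x p) ⁻¹' posetLimits) ?_ ?_ hx
  · rintro _ ⟨P, rfl⟩
    induction P using Quotient.inductionOn with
    | h P => exact thinVector_embed_mem P p
  · exact isClosed_closure.preimage
      (continuous_thinVector.comp (continuous_id.prodMk continuous_const))

theorem thinVector_mem_properPosetLimits {x : (UPoset → I) × I} (hx : x ∈ posetLimits) (p : I) :
    thinVector x p ∈ properPosetLimits := by
  refine ⟨thinVector_mem_posetLimits hx p, ?_⟩
  rintro ⟨P, hP⟩
  induction P using Quotient.inductionOn with
  | h P =>
    have h : ((P.n : ℝ))⁻¹ = 0 := congrArg (fun x : (UPoset → I) × I => (x.2 : ℝ)) hP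
    have := P.pos
    rw [inv_eq_zero, Nat.cast_eq_zero] at h
    omega

/-- Near a point with positive last coordinate there are only finite posets of bounded size. These
are finitely many, hence form a closed set, so the point would itself be a finite poset. -/
theorem ProperPosetLimit.snd_eq_zero (Γ : ProperPosetLimit) : (Γ : (UPoset → I) × I).2 = 0 := by
  obtain ⟨x, hx, hx'⟩ := Γ
  by_contra h
  have hpos : 0 < (x.2 : ℝ) := unitInterval.pos_iff_ne_zero.2 h
  obtain ⟨N, hN⟩ := exists_nat_gt (x.2 : ℝ)⁻¹
  have hU : IsOpen {y : (UPoset → I) × I | (N : ℝ)⁻¹ < (y.2 : ℝ)} :=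
    isOpen_lt continuous_const (by fun_prop)
  have hxU : x ∈ {y : (UPoset → I) × I | (N : ℝ)⁻¹ < (y.2 : ℝ)} := inv_lt_of_inv_lt₀ hpos hN
  have hfin : (UPoset.embed '' {P | P.size ≤ N}).Finite := (UPoset.finite_size_le N).image _
  have hmem : x ∈ closure ({y : (UPoset → I) × I | (N : ℝ)⁻¹ < (y.2 : ℝ)} ∩
      Set.range UPoset.embed) := hU.inter_closure ⟨hxU, hx⟩
  have hsub : {y : (UPoset → I) × I | (N : ℝ)⁻¹ < (y.2 : ℝ)} ∩ Set.range UPoset.embed ⊆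
      UPoset.embed '' {P | P.size ≤ N} := by
    rintro _ ⟨hy, P, rfl⟩
    refine ⟨P, ?_, rfl⟩
    have hy' : (N : ℝ)⁻¹ < (P.size : ℝ)⁻¹ := hy
    by_contra hlt
    have hlt' : N < P.size := not_le.1 hlt
    have hN0 : (0 : ℝ) < N := (inv_pos.2 hpos).trans hN
    exact absurd hy' (not_lt.2 (inv_anti₀ hN0 (by exact_mod_cast hlt'.le)))
  have := hfin.isClosed.closure_eq ▸ closure_mono hsub hmem
  exact hx' (Set.image_subset_range _ _ this)

/-! ### The contraction of the space of proper limits -/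

namespace ProperPosetLimit

/-- The thinning of a proper poset limit. -/
noncomputable def thin (Γ : ProperPosetLimit) (p : I) : ProperPosetLimit :=
  ⟨thinVector Γ p, thinVector_mem_properPosetLimits Γ.2.1 p⟩

theorem t_thin (Γ : ProperPosetLimit) (p : I) (Q : FinPoset) :
    (Γ.thin p).t Q = (p : ℝ) ^ Q.numComparable * Γ.t Q := rfl

-- The remaining coordinate is 0 for every proper limit, so the densities suffice.
@[ext]
theorem ext_t {Γ Γ' : ProperPosetLimit} (h : ∀ Q, Γ.t Q = Γ'.t Q) : Γ = Γ' := by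
  refine Subtype.ext (Prod.ext (funext fun Q => ?_) (by rw [Γ.snd_eq_zero, Γ'.snd_eq_zero]))
  induction Q using Quotient.inductionOn with
  | h Q => exact Subtype.ext (h Q)

theorem thin_one (Γ : ProperPosetLimit) : Γ.thin 1 = Γ := by
  ext Q
  simp [t_thin]

theorem continuous_thin : Continuous fun z : ProperPosetLimit × I => z.1.thin z.2 :=
  Continuous.subtype_mk (continuous_thinVector.comp
    ((continuous_subtype_val.comp continuous_fst).prodMk continuous_snd)) _

theorem t_eq_one {Q : FinPoset} (h : ¬ ∃ x y, Q.lt x y) (Γ : ProperPosetLimit) : Γ.t Q = 1 := by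
  refine closure_minimal (s := Set.range UPoset.embed)
    (t := {x : (UPoset → I) × I | (x.1 Q.unlabel : ℝ) = 1}) ?_ ?_ Γ.2.1
  · rintro _ ⟨P, rfl⟩
    induction P using Quotient.inductionOn with
    | h P => exact FinPoset.homDensity_eq_one h P
  · exact isClosed_eq (by fun_prop) continuous_const

/-- The proper poset limit in which almost surely no two points are comparable. -/
noncomputable def edgeless : ProperPosetLimit :=
  -- Any finite poset would do here; the one-point poset is the simplest.
  ⟨thinVector (FinPoset.unlabel ⟨1, one_pos, fun _ _ => False, fun _ => id,
      fun _ _ _ h => h.elim⟩).embed 0,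
    thinVector_mem_properPosetLimits (subset_closure (Set.mem_range_self _)) 0⟩

theorem t_edgeless_eq_zero {Q : FinPoset} (h : ∃ x y, Q.lt x y) : edgeless.t Q = 0 := by
  change ((0 : I) : ℝ) ^ Q.numComparable * _ = _
  simp [FinPoset.numComparable_ne_zero h]

/-- When Q has comparable elements the factor 0 ^ n(Q) vanishes; otherwise both densities are 1,
whatever the limit. -/
theorem thin_zero (Γ : ProperPosetLimit) : Γ.thin 0 = edgeless := by
  ext Q
  by_cases h : ∃ x y, Q.lt x y
  · simp [t_thin, t_edgeless_eq_zero h, FinPoset.numComparable_ne_zero h]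
  · rw [t_eq_one h, t_eq_one h]

/-- The homotopy contracting the space of proper poset limits by thinning. -/
noncomputable def thinHomotopy : (ContinuousMap.id ProperPosetLimit).Homotopy
    (ContinuousMap.const ProperPosetLimit edgeless) where
  toFun z := z.2.thin (σ z.1)
  continuous_toFun := continuous_thin.comp
    (continuous_snd.prodMk (unitInterval.continuous_symm.comp continuous_fst))
  map_zero_left Γ := by simp [thin_one]
  map_one_left Γ := by simp [thin_zero]

theorem thinHomotopy_apply (p : I) (Γ : ProperPosetLimit) :
    thinHomotopy (σ p, Γ) = Γ.thin p := by
  change Γ.thin (σ (σ p)) = _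
  rw [unitInterval.symm_symm]

end ProperPosetLimit

instance : ContractibleSpace ProperPosetLimit :=
  (contractible_iff_id_nullhomotopic _).2
    ⟨ProperPosetLimit.edgeless, ⟨ProperPosetLimit.thinHomotopy⟩⟩

/-! ### Random infinite posets -/

/-- The space of strict orders on `ℕ`, as a closed subspace of a product of two-point spaces. -/
def NatOrder : Set (ℕ → ℕ → Bool) :=
  {r | (∀ i, r i i = false) ∧ ∀ i j k, r i j = true → r j k = true → r i k = true}

namespace NatOrder

theorem isClosed : IsClosed NatOrder := by
  have hev : ∀ i j : ℕ, Continuous fun r : ℕ → ℕ → Bool => r i j := fun i j =>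
    (continuous_apply j).comp (continuous_apply i)
  have hev' : ∀ i j : ℕ, ∀ b : Bool, IsClopen {r : ℕ → ℕ → Bool | r i j = b} := fun i j b =>
    (isClopen_discrete {b}).preimage (hev i j)
  have h1 : IsClosed {r : ℕ → ℕ → Bool | ∀ i, r i i = false} := by
    rw [Set.ofPred_forall]
    exact isClosed_iInter fun i => (hev' i i false).1
  have h2 : IsClosed {r : ℕ → ℕ → Bool |
      ∀ i j k, r i j = true → r j k = true → r i k = true} := by
    simp only [Set.ofPred_forall]
    exact isClosed_iInter fun i => isClosed_iInter fun j => isClosed_iInter fun k =>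
      isClosed_imp (hev' i j true).2 (isClosed_imp (hev' j k true).2 (hev' i k true).1)
  exact h1.inter h2

instance : CompactSpace NatOrder := isCompact_iff_compactSpace.mp isClosed.isCompact

/-- The set of strict orders on `ℕ` which contain `Q`. -/
def containing (Q : FinPoset) : Set NatOrder := {r | ∀ i j : Fin Q.n, Q.lt i j → r.1 i j = true}

theorem isClopen_containing (Q : FinPoset) : IsClopen (containing Q) := by
  have : containing Q = ⋂ i : Fin Q.n, ⋂ j : Fin Q.n, ⋂ _ : Q.lt i j,
      {r : NatOrder | r.1 i j = true} := by
    ext r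
    simp [containing]
  rw [this]
  refine isClopen_iInter_of_finite fun i => isClopen_iInter_of_finite fun j =>
    isClopen_iInter_of_finite fun _ => (isClopen_discrete {true}).preimage ?_
  exact (continuous_apply (j : ℕ)).comp ((continuous_apply (i : ℕ)).comp continuous_subtype_val)

open Classical in
/-- The order on `ℕ` pulled back from a finite poset along a map. -/
noncomputable def pullback (P : FinPoset) (x : ℕ → Fin P.n) : NatOrder :=
  ⟨fun i j => decide (P.lt (x i) (x j)), by simp [P.irrefl], by
    simpa using fun i j k => P.trans (x i) (x j) (x k)⟩

theorem measurable_pullback (P : FinPoset) : Measurable (pullback P) := by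
  classical
  refine Measurable.subtype_mk (measurable_pi_iff.2 fun i => measurable_pi_iff.2 fun j => ?_)
  have hpair : Measurable fun x : ℕ → Fin P.n => (x i, x j) := by fun_prop
  exact (measurable_of_countable fun y : Fin P.n × Fin P.n => decide (P.lt y.1 y.2)).comp hpair

/-- The uniform probability measure on a finite poset. -/
noncomputable def uniform (P : FinPoset) : Measure (Fin P.n) := uniformOn Set.univ

instance (P : FinPoset) : IsProbabilityMeasure (uniform P) :=
  have : Nonempty (Fin P.n) := ⟨⟨0, P.pos⟩⟩
  isProbabilityMeasure_uniformOn Set.finite_univ Set.univ_nonempty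

theorem uniform_real_singleton (P : FinPoset) (x : Fin P.n) :
    (uniform P).real {x} = (P.n : ℝ)⁻¹ := by
  simp [uniform, Measure.real, uniformOn_univ]

theorem map_infinitePi_fin {X : Type*} [MeasurableSpace X] (μ : Measure X)
    [IsProbabilityMeasure μ] (n : ℕ) :
    (Measure.infinitePi fun _ : ℕ => μ).map (fun x (i : Fin n) => x i) =
      Measure.pi fun _ : Fin n => μ := by
  refine (Measure.pi_eq fun s hs => ?_).symm
  rw [Measure.map_apply (by fun_prop) (MeasurableSet.univ_pi hs)]
  let t : ℕ → Set X := fun k => if h : k < n then s ⟨k, h⟩ else Set.univ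
  have ht : ∀ i : Fin n, t i = s i := fun i => by simp [t]
  have : (fun (x : ℕ → X) (i : Fin n) => x i) ⁻¹' Set.univ.pi s =
      Set.pi (Finset.range n : Finset ℕ) t := by
    ext x
    simp only [Set.mem_preimage, Set.mem_pi, Finset.coe_range, Set.mem_Iio]
    refine ⟨fun h k hk => ?_, fun h i _ => ht i ▸ h i i.2⟩
    simpa [t, hk] using h ⟨k, hk⟩ trivial
  rw [this, Measure.infinitePi_pi, Finset.prod_range]
  · simp [ht]
  · intro k _
    simp only [t]
    split_ifs
    exacts [hs _, MeasurableSet.univ]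

/-- The random order on `ℕ` obtained by sampling independent uniform points of a finite poset. -/
noncomputable def sample (P : FinPoset) : ProbabilityMeasure NatOrder :=
  ⟨(Measure.infinitePi fun _ : ℕ => uniform P).map (pullback P),
    Measure.isProbabilityMeasure_map (measurable_pullback P).aemeasurable⟩

/-- Containing Q depends only on the first |Q| sampled points, which form a uniformly random map
from Q to P; the event is that this map is a homomorphism. -/
theorem sample_containing (Q P : FinPoset) :
    (sample P : Measure NatOrder).real (containing Q) = Q.homDensity P := by
  classical
  have hpre : pullback P ⁻¹' containing Q = (fun x (i : Fin Q.n) => x i) ⁻¹'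
      {f : Fin Q.n → Fin P.n | ∀ i j, Q.lt i j → P.lt (f i) (f j)} := by
    ext x
    simp [containing, pullback]
  change ((Measure.infinitePi fun _ : ℕ => uniform P).map (pullback P)).real _ = _
  rw [Measure.real, Measure.map_apply (measurable_pullback P)
    (isClopen_containing Q).1.measurableSet, hpre, ← Measure.map_apply (by fun_prop)
    (Set.to_countable _).measurableSet, map_infinitePi_fin]
  change (Measure.pi fun _ : Fin Q.n => uniform P).real _ = _
  have hfin : {f : Fin Q.n → Fin P.n | ∀ i j, Q.lt i j → P.lt (f i) (f j)} =
      (↑({f | ∀ i j, Q.lt i j → P.lt (f i) (f j)} : Finset (Fin Q.n → Fin P.n)) : Set _) := by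
    simp
  have hsing : ∀ f : Fin Q.n → Fin P.n,
      (Measure.pi fun _ : Fin Q.n => uniform P).real {f} = ((P.n : ℝ)⁻¹) ^ Q.n := by
    intro f
    rw [Measure.real, Measure.pi_singleton, ENNReal.toReal_prod]
    have := fun i => uniform_real_singleton P (f i)
    simp only [Measure.real] at this
    simp [this]
  rw [hfin, ← sum_measureReal_singleton]
  simp only [hsing, Finset.sum_const, nsmul_eq_mul]
  have hcard : Nat.card (Q.lt →r P.lt) =
      ({f | ∀ i j, Q.lt i j → P.lt (f i) (f j)} : Finset (Fin Q.n → Fin P.n)).card := by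
    rw [← Fintype.card_subtype, ← Nat.card_eq_fintype_card]
    exact Nat.card_congr ⟨fun f => ⟨f, fun _ _ h => f.map_rel h⟩,
      fun f => ⟨f.1, fun {a b} h => f.2 a b h⟩, fun _ => rfl, fun _ => rfl⟩
  rw [FinPoset.homDensity, hcard, Nat.card_eq_fintype_card, Fintype.card_pi_const,
    Fintype.card_fin, div_eq_mul_inv, Nat.cast_pow, inv_pow]

/-- Every poset limit is the vector of containment probabilities of some random order on `ℕ`. -/
theorem exists_probabilityMeasure {x : (UPoset → I) × I} (hx : x ∈ posetLimits) :
    ∃ μ : ProbabilityMeasure NatOrder, ∀ Q : FinPoset,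
      (μ : Measure NatOrder).real (containing Q) = x.1 Q.unlabel := by
  let F : ProbabilityMeasure NatOrder → FinPoset → ℝ := fun μ Q =>
    (μ : Measure NatOrder).real (containing Q)
  have hF : Continuous F := by
    refine continuous_pi fun Q => continuous_iff_continuousAt.2 fun μ => ?_
    exact (NNReal.continuous_coe.tendsto _).comp
      (ProbabilityMeasure.tendsto_measure_of_isClopen_of_tendsto Filter.tendsto_id
        (isClopen_containing Q))
  have hG : Continuous fun (x : (UPoset → I) × I) (Q : FinPoset) => (x.1 Q.unlabel : ℝ) := by
    fun_prop
  -- The range of `F` is compact, hence closed, because the probability measures on the compact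
  -- space `NatOrder` form a compact space. It is therefore enough to treat finite posets.
  have hsub := closure_minimal (s := Set.range UPoset.embed)
    (t := (fun (x : (UPoset → I) × I) (Q : FinPoset) => (x.1 Q.unlabel : ℝ)) ⁻¹' Set.range F)
    ?_ ((isCompact_range hF).isClosed.preimage hG) hx
  · obtain ⟨μ, hμ⟩ := hsub
    exact ⟨μ, congrFun hμ⟩
  · rintro _ ⟨P, rfl⟩
    induction P using Quotient.inductionOn with
    | h P => exact ⟨sample P, funext fun Q => sample_containing Q P⟩

end NatOrder

theorem ProperPosetLimit.exists_isInfinitePosetOf (Γ : ProperPosetLimit) :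
    ∃ (Ω : Type) (_ : MeasurableSpace Ω) (P : Measure Ω) (_ : IsProbabilityMeasure P)
      (R : Ω → ℕ → ℕ → Prop), IsInfinitePosetOf P R Γ := by
  obtain ⟨μ, hμ⟩ := NatOrder.exists_probabilityMeasure Γ.2.1
  refine ⟨NatOrder, inferInstance, μ, inferInstance, fun r i j => r.1 i j = true, ?_, ?_, hμ⟩
  · refine measurable_pi_iff.2 fun i => measurable_pi_iff.2 fun j => ?_
    exact (measurable_of_countable fun b : Bool => b = true).comp
      ((measurable_pi_apply j).comp ((measurable_pi_apply i).comp measurable_subtype_coe))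
  · intro r
    exact { irrefl := fun i h => by simp [r.2.1 i] at h, trans := r.2.2 }

/-- Containment of Q after thinning is the intersection of an event about `keep` and an event about
`R`, which are independent. -/
theorem IsInfinitePosetOf.thinRel {Ω : Type*} [MeasurableSpace Ω] {P : Measure Ω}
    [IsProbabilityMeasure P] {R : Ω → ℕ → ℕ → Prop} {keep : ℕ → Ω → Prop}
    {Γ : ProperPosetLimit} {p : I} (hR : IsInfinitePosetOf P R Γ)
    (hkeep : IsThinningOf P R keep p) : IsInfinitePosetOf P (thinRel R keep) (Γ.thin p) := by
  classical
  obtain ⟨hRm, hRo, hRt⟩ := hR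
  obtain ⟨hkm, hkp, hki, hkR⟩ := hkeep
  refine ⟨?_, fun ω => ?_, fun Q => ?_⟩
  · refine measurable_pi_iff.2 fun i => measurable_pi_iff.2 fun j => ?_
    exact (hkm i).and ((hkm j).and (measurable_pi_iff.1 (measurable_pi_iff.1 hRm i) j))
  · have := hRo ω
    exact { irrefl := fun i h => irrefl_of (R ω) i h.2.2
            trans := fun i j k h h' => ⟨h.1, h'.2.1, trans_of (R ω) h.2.2 h'.2.2⟩ }
  · let A : Set (ℕ → Prop) := {b | ∀ i : Fin Q.n, Q.IsComparable i → b i}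
    let B : Set (ℕ → ℕ → Prop) := {r | ∀ i j : Fin Q.n, Q.lt i j → r i j}
    have hA : MeasurableSet A := by
      refine measurableSet_setOfPred.2 (Measurable.forall fun i => Measurable.imp measurable_const ?_)
      exact measurable_pi_apply (i : ℕ)
    have hB : MeasurableSet B := by
      refine measurableSet_setOfPred.2 (Measurable.forall fun i => Measurable.forall fun j =>
        Measurable.imp measurable_const ?_)
      exact (measurable_pi_apply (j : ℕ)).comp (measurable_pi_apply (i : ℕ))
    have hset : {ω | ∀ i j : Fin Q.n, Q.lt i j → _root_.thinRel R keep ω i j} =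
        (fun ω i => keep i ω) ⁻¹' A ∩ R ⁻¹' B := by
      ext ω
      simp only [Set.mem_ofPred_eq, Set.mem_inter_iff, Set.mem_preimage, A, B, _root_.thinRel]
      refine ⟨fun h => ⟨?_, fun i j hij => (h i j hij).2.2⟩, fun h i j hij =>
        ⟨h.1 i ⟨j, Or.inl hij⟩, h.1 j ⟨i, Or.inr hij⟩, h.2 i j hij⟩⟩
      rintro i ⟨j, hij | hji⟩
      · exact (h i j hij).1
      · exact (h j i hji).2.1
    have hPA : P.real ((fun ω i => keep i ω) ⁻¹' A) = (p : ℝ) ^ Q.numComparable := by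
      -- Elements that are incomparable to all others impose a vacuous condition, of probability 1,
      -- so independence can be applied over all of `Fin Q.n`.
      have hinter : (fun ω i => keep i ω) ⁻¹' A =
          ⋂ i : Fin Q.n, {ω | Q.IsComparable i → keep i ω} := by
        ext ω
        simp [A]
      have hind : iIndepFun (fun i : Fin Q.n => keep i) P := hki.precomp Fin.val_injective
      rw [Measure.real, hinter, hind.meas_iInter, ENNReal.toReal_prod,
        ← Q.prod_ite_isComparable (p : ℝ)]
      · refine Finset.prod_congr rfl fun i _ => ?_
        split_ifs with hi
        · simp only [hi, true_imp_iff]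
          exact hkp i
        · simp [hi]
      · intro i
        exact ⟨{b | Q.IsComparable i → b}, MeasurableSpace.measurableSet_top, rfl⟩
    rw [hset, Measure.real, hkR.measure_inter_preimage_eq_mul A B hA hB, ENNReal.toReal_mul,
      ProperPosetLimit.t_thin]
    exact congrArg₂ (· * ·) hPA (hRt Q)

/-! ### Thinning of kernels -/

/-- The law of a coin which shows `true` with probability `p`. -/
noncomputable def coinMeasure (p : I) : Measure Bool :=
  ENNReal.ofReal p • Measure.dirac true + ENNReal.ofReal (1 - p) • Measure.dirac false

instance (p : I) : IsProbabilityMeasure (coinMeasure p) := by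
  refine ⟨?_⟩
  simp only [coinMeasure, Measure.coe_add, Measure.coe_smul, Pi.add_apply, Pi.smul_apply,
    measure_univ, smul_eq_mul, mul_one]
  rw [← ENNReal.ofReal_add p.2.1 (sub_nonneg.2 p.2.2)]
  simp

theorem integral_coinMeasure (p : I) (f : Bool → ℝ) :
    ∫ b, f b ∂coinMeasure p = p * f true + (1 - p) * f false := by
  rw [coinMeasure, integral_add_measure (Integrable.of_finite.smul_measure ENNReal.ofReal_ne_top)
    (Integrable.of_finite.smul_measure ENNReal.ofReal_ne_top), integral_smul_measure,
    integral_smul_measure, integral_dirac, integral_dirac, ENNReal.toReal_ofReal p.2.1,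
    ENNReal.toReal_ofReal (sub_nonneg.2 p.2.2), smul_eq_mul, smul_eq_mul]

section

variable {S : Type*} [MeasurableSpace S]

/-- The map which keeps a point of `S` if the coin shows `true`, and sends it to the extra point
otherwise. -/
def keepOrDrop (z : S × Bool) : S ⊕ Unit := if z.2 then Sum.inl z.1 else Sum.inr ()

theorem measurable_keepOrDrop : Measurable (keepOrDrop : S × Bool → S ⊕ Unit) :=
  Measurable.ite (measurable_snd (measurableSet_singleton true))
    (measurable_inl.comp measurable_fst) measurable_const

/-- Splitting the coin measure into its two atoms gives p times the copy of μ on S and mass 1 - p at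
the extra point. -/
theorem map_keepOrDrop (μ : Measure S) [IsProbabilityMeasure μ] (p : I) :
    (μ.prod (coinMeasure p)).map keepOrDrop = addPointMeasure μ p := by
  have hm := measurable_keepOrDrop (S := S)
  rw [coinMeasure, Measure.prod_add, Measure.prod_smul_right, Measure.prod_smul_right,
    Measure.prod_dirac, Measure.prod_dirac, Measure.map_add _ _ hm, Measure.map_smul,
    Measure.map_smul, Measure.map_map hm (by fun_prop), Measure.map_map hm (by fun_prop)]
  have h1 : (keepOrDrop ∘ fun x : S => (x, true)) = Sum.inl := rfl
  have h2 : (keepOrDrop ∘ fun x : S => (x, false)) = fun _ => Sum.inr () := rfl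
  rw [h1, h2, Measure.map_const, measure_univ, one_smul]
  rfl

theorem measurePreserving_pi_keepOrDrop (μ : Measure S) [IsProbabilityMeasure μ] (p : I)
    (n : ℕ) :
    MeasurePreserving (fun (z : (Fin n → S) × (Fin n → Bool)) i => keepOrDrop (z.1 i, z.2 i))
      ((Measure.pi fun _ => μ).prod (Measure.pi fun _ => coinMeasure p))
      (Measure.pi fun _ => addPointMeasure μ p) := by
  have h1 := (measurePreserving_arrowProdEquivProdArrow S Bool (Fin n) (fun _ => μ)
    (fun _ => coinMeasure p)).symm
  have hkd : MeasurePreserving keepOrDrop (μ.prod (coinMeasure p)) (addPointMeasure μ p) :=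
    ⟨measurable_keepOrDrop, map_keepOrDrop μ p⟩
  have : IsProbabilityMeasure (addPointMeasure μ p) :=
    map_keepOrDrop μ p ▸ Measure.isProbabilityMeasure_map measurable_keepOrDrop.aemeasurable
  exact (measurePreserving_pi (fun _ : Fin n => μ.prod (coinMeasure p))
    (fun _ => addPointMeasure μ p) fun _ => hkd).comp h1

namespace PosetKernel

open Classical in
/-- The integrand in the definition of the density of `Q` in a kernel. -/
noncomputable def integrand (K : PosetKernel S) (Q : FinPoset) (x : Fin Q.n → S) : ℝ :=
  ∏ i, ∏ j, if Q.lt i j then K.W (x i) (x j) else 1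

theorem measurable_integrand (K : PosetKernel S) (Q : FinPoset) : Measurable (K.integrand Q) := by
  classical
  refine Finset.measurable_prod _ fun i _ => Finset.measurable_prod _ fun j _ => ?_
  split_ifs
  · have hpair : Measurable fun x : Fin Q.n → S => (x i, x j) := by fun_prop
    exact K.measurable_W.comp hpair
  · exact measurable_const

-- A dropped comparable element kills some factor of the product, while dropping an isolated element
-- changes nothing. Thus the integrand separates into a function of the points and a function of the
-- coins.
open Classical in
theorem integrand_addPoint_keepOrDrop (K : PosetKernel S) (Q : FinPoset) (x : Fin Q.n → S)
    (b : Fin Q.n → Bool) :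
    K.addPoint.integrand Q (fun i => keepOrDrop (x i, b i)) =
      K.integrand Q x * ∏ i, if Q.IsComparable i ∧ b i = false then 0 else 1 := by
  by_cases h : ∃ i, Q.IsComparable i ∧ b i = false
  · obtain ⟨i, hi, hb⟩ := h
    have hdrop : keepOrDrop (x i, b i) = Sum.inr () := by simp [keepOrDrop, hb]
    have hzero : ∏ i, (if Q.IsComparable i ∧ b i = false then (0 : ℝ) else 1) = 0 :=
      Finset.prod_eq_zero (Finset.mem_univ i) (if_pos ⟨hi, hb⟩)
    rw [hzero, mul_zero, integrand]
    obtain ⟨j, hij | hji⟩ := hi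
    · refine Finset.prod_eq_zero (Finset.mem_univ i)
        (Finset.prod_eq_zero (Finset.mem_univ j) ?_)
      rw [if_pos hij, hdrop]
      rfl
    · refine Finset.prod_eq_zero (Finset.mem_univ j)
        (Finset.prod_eq_zero (Finset.mem_univ i) ?_)
      rw [if_pos hji, hdrop]
      -- The extended kernel is defined by matching on both arguments, so its vanishing at a dropped
      -- second argument needs cases on the first.
      cases keepOrDrop (x j, b j) <;> rfl
  · have hone : ∀ i, (if Q.IsComparable i ∧ b i = false then (0 : ℝ) else 1) = 1 := fun i =>
      if_neg fun hi => h ⟨i, hi⟩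
    have hkept : ∀ i, Q.IsComparable i → keepOrDrop (x i, b i) = Sum.inl (x i) := fun i hi => by
      have : b i = true := by
        by_contra hb
        exact h ⟨i, hi, by simpa using hb⟩
      simp [keepOrDrop, this]
    simp only [hone, Finset.prod_const_one, mul_one, integrand]
    refine Finset.prod_congr rfl fun i _ => Finset.prod_congr rfl fun j _ => ?_
    split_ifs with hij
    · rw [hkept i ⟨j, Or.inl hij⟩, hkept j ⟨i, Or.inr hij⟩]
      rfl
    · rfl

theorem integral_integrand_addPoint (K : PosetKernel S) (μ : Measure S) [IsProbabilityMeasure μ]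
    (p : I) (Q : FinPoset) :
    ∫ x, K.addPoint.integrand Q x ∂(Measure.pi fun _ => addPointMeasure μ p) =
      (p : ℝ) ^ Q.numComparable * ∫ x, K.integrand Q x ∂(Measure.pi fun _ => μ) := by
  classical
  have hmp := measurePreserving_pi_keepOrDrop μ p Q.n
  rw [← hmp.map_eq, integral_map hmp.measurable.aemeasurable
    (K.addPoint.measurable_integrand Q).aestronglyMeasurable]
  simp only [integrand_addPoint_keepOrDrop]
  -- Fubini separates points from coins, and the coin integral factors over the elements of Q: a
  -- comparable element contributes p, any other contributes 1.
  rw [integral_prod_mul (K.integrand Q) (fun b : Fin Q.n → Bool =>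
    ∏ i, if Q.IsComparable i ∧ b i = false then (0 : ℝ) else 1), mul_comm,
    integral_fintype_prod_eq_prod (fun i (c : Bool) =>
      if Q.IsComparable i ∧ c = false then (0 : ℝ) else 1), ← Q.prod_ite_isComparable]
  congr 1
  refine Finset.prod_congr rfl fun i _ => ?_
  rw [integral_coinMeasure]
  split_ifs with hi <;> simp_all

theorem Represents.addPoint {K : PosetKernel S} {μ : Measure S} [IsProbabilityMeasure μ]
    {Γ : ProperPosetLimit} (h : K.Represents μ Γ) (p : I) :
    K.addPoint.Represents (addPointMeasure μ p) (Γ.thin p) := by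
  intro Q
  rw [ProperPosetLimit.t_thin, h Q]
  exact (integral_integrand_addPoint K μ p Q).symm

end PosetKernel

end

/-! ### Assembly of the theorem -/

theorem theorem11p1 :
    ContractibleSpace ProperPosetLimit ∧
    ConnectedSpace ProperPosetLimit ∧
    SimplyConnectedSpace ProperPosetLimit ∧
    ∃ (Γ₀ : ProperPosetLimit)
      (Ψ : (ContinuousMap.id ProperPosetLimit).Homotopy
        (ContinuousMap.const ProperPosetLimit Γ₀)),
      -- the homotopy at time `1 - p` multiplies `t(Q, ·)` by `p ^ n(Q)`
      (∀ (Γ : ProperPosetLimit) (p : I) (Q : FinPoset),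
        (Ψ (σ p, Γ)).t Q = (p : ℝ) ^ Q.numComparable * Γ.t Q) ∧
      -- it thins the random infinite poset of `Γ`
      (∀ Γ : ProperPosetLimit, ∃ (Ω : Type) (_ : MeasurableSpace Ω) (P : Measure Ω)
        (_ : IsProbabilityMeasure P) (R : Ω → ℕ → ℕ → Prop), IsInfinitePosetOf P R Γ) ∧
      (∀ (Γ : ProperPosetLimit) (p : I) (Ω : Type*) [MeasurableSpace Ω] (P : Measure Ω)
        [IsProbabilityMeasure P] (R : Ω → ℕ → ℕ → Prop) (keep : ℕ → Ω → Prop),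
        IsInfinitePosetOf P R Γ → IsThinningOf P R keep p →
          IsInfinitePosetOf P (thinRel R keep) (Ψ (σ p, Γ))) ∧
      -- it thins every kernel representing `Γ`
      (∀ (Γ : ProperPosetLimit) (p : I) (S : Type*) [MeasurableSpace S] (μ : Measure S)
        [IsProbabilityMeasure μ] (K : PosetKernel S),
        K.Represents μ Γ → K.addPoint.Represents (addPointMeasure μ p) (Ψ (σ p, Γ))) ∧
      -- the end point of the homotopy
      (∀ Q : FinPoset, ((∃ x y, Q.lt x y) → Γ₀.t Q = 0) ∧ ((¬ ∃ x y, Q.lt x y) → Γ₀.t Q = 1)) := by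
  refine ⟨inferInstance, inferInstance, inferInstance, ProperPosetLimit.edgeless,
    ProperPosetLimit.thinHomotopy, ?_, fun Γ => Γ.exists_isInfinitePosetOf, ?_, ?_, fun Q =>
      ⟨ProperPosetLimit.t_edgeless_eq_zero, fun h => ProperPosetLimit.t_eq_one h _⟩⟩
  · intro Γ p Q
    rw [ProperPosetLimit.thinHomotopy_apply, ProperPosetLimit.t_thin]
  · intro Γ p Ω _ P _ R keep hR hkeep
    rw [ProperPosetLimit.thinHomotopy_apply]
    exact hR.thinRel hkeep
  · intro Γ p S _ μ _ K hK
    rw [ProperPosetLimit.thinHomotopy_apply]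
    exact hK.addPoint p
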